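/- Let $1\le k\le n$. In $\mathbb{Q}[x_1,\dots,x_n]$ let $e_d$ be the degree-$d$ elementary symmetric polynomial in $x_1,\dots,x_n$, and let $e_d^{(i)}$ be the degree-$d$ elementary symmetric polynomial in the variables $x_1,\dots,x_{i-1},x_{i+1},\dots,x_n$ (so $e_0^{(i)}=1$, and $e_d^{(i)}=0$ for $d<0$). Put $$J_{n,k}=\big\langle x_i^d\, e_{n-r}^{(i)} : 1\le i\le n,\ 1\le r\le d\big\rangle+\langle e_n,e_{n-1},\dots,e_{n-k+1}\rangle,\qquad S_{n,k}=\mathbb{Q}[x_1,\dots,x_n]/J_{n,k}.$$ For an ordered set partition $\sigma=(B_1\mid\cdots\mid B_\ell)$ of $[n]=\{1,\dots,n\}$ into nonempty blocks, its boosted coinversion code is the sequence $(c_1,\dots,c_n)$ given, for $i\in B_j$, by $$c_i=\begin{cases}|\{m>j:\min(B_m)>i\}| & \text{if } i=\min(B_j),\\ |\{m>j:\min(B_m)>i\}|+j & \text{if } i\ne\min(B_j).\end{cases}$$ Order monomials lexicographically with $x_n>x_{n-1}>\cdots>x_1$: for $a\neq b$, $x^a<x^b$ if and only if $a_j<b_j$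 for the largest index $j$ with $a_j\ne b_j$. The standard monomials of $S_{n,k}$ are the monomials that do not lie in the ideal generated by the leading monomials of all nonzero elements of $J_{n,k}$. Then the set of standard monomials of $S_{n,k}$ is exactly the set of monomials $x_1^{c_1}\cdots x_n^{c_n}$ where $(c_1,\dots,c_n)$ is the boosted coinversion code of some ordered set partition of $[n]$ with at least $k$ blocks, and the images of these monomials form a $\mathbb{Q}$-basis of $S_{n,k}$. -/

import Mathlib

namespace StdMonomials

open MvPolynomial

/-! ### Ordered set partitions and boosted coinversion codes

The ground set `[n] = {1, …, n}` is modelled by `Fin n` and block positions `1, …, ℓ` by `Fin ℓ`,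
so the (one-based) position of the block `j : Fin ℓ` is `j + 1`. -/

/-- An ordered set partition `(B₁ ∣ ⋯ ∣ B_ℓ)` of `[n]` into `ℓ` blocks. -/
structure OrderedSetPartition (n ℓ : ℕ) where
  /-- the sequence of blocks -/
  block : Fin ℓ → Finset (Fin n)
  block_nonempty : ∀ j, (block j).Nonempty
  existsUnique_mem : ∀ i, ∃! j, i ∈ block j

namespace OrderedSetPartition

variable {n ℓ : ℕ} (σ : OrderedSetPartition n ℓ)

/-- The (zero-based) position of the block that contains `i`. -/
noncomputable def blockIndex (i : Fin n) : Fin ℓ :=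
  (σ.existsUnique_mem i).choose

theorem mem_block_blockIndex (i : Fin n) : i ∈ σ.block (σ.blockIndex i) :=
  (σ.existsUnique_mem i).choose_spec.1

theorem blockIndex_eq {i : Fin n} {j : Fin ℓ} (h : i ∈ σ.block j) : σ.blockIndex i = j :=
  ((σ.existsUnique_mem i).choose_spec.2 j h).symm

/-- The minimum `min(B_j)` of a block. -/
def blockMin (j : Fin ℓ) : Fin n :=
  (σ.block j).min' (σ.block_nonempty j)

/-- The boosted coinversion code: for `i ∈ B_j`, the entry `c_i` is
`#{l > j : min(B_l) > i}` if `i = min(B_j)`, and `#{l > j : min(B_l) > i} + j` otherwise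
(where `j` is the one-based position of the block). -/
noncomputable def boostedCode (i : Fin n) : ℕ :=
  (Finset.univ.filter fun l : Fin ℓ => σ.blockIndex i < l ∧ i < σ.blockMin l).card +
    if i = σ.blockMin (σ.blockIndex i) then 0 else (σ.blockIndex i : ℕ) + 1

end OrderedSetPartition

/-! ### The ideal `J_{n,k}` and the quotient ring `S_{n,k}` -/

/-- `e_d^{(i)}`: the elementary symmetric polynomial of degree `d` in the variables
`x_1, …, x_n` with `x_i` omitted. -/
noncomputable def esymmOmit (n : ℕ) (i : Fin n) (d : ℕ) : MvPolynomial (Fin n) ℚ :=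
  ∑ s ∈ (Finset.univ.erase i).powersetCard d, ∏ j ∈ s, X j

/-- `J_n = ⟨x_i^d · e_{n-r}^{(i)} : 1 ≤ i ≤ n, 1 ≤ r ≤ d⟩`. As elementary symmetric polynomials
of negative degree vanish, only the generators with `r ≤ n` are listed. -/
noncomputable def idealJ₀ (n : ℕ) : Ideal (MvPolynomial (Fin n) ℚ) :=
  Ideal.span {p | ∃ (i : Fin n) (d r : ℕ), 1 ≤ r ∧ r ≤ d ∧ r ≤ n ∧
    p = X i ^ d * esymmOmit n i (n - r)}

/-- `J_{n,k} = J_n + ⟨e_n, e_{n-1}, …, e_{n-k+1}⟩`. -/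
noncomputable def idealJ (n k : ℕ) : Ideal (MvPolynomial (Fin n) ℚ) :=
  idealJ₀ n ⊔ Ideal.span {p | ∃ d : ℕ, n + 1 ≤ d + k ∧ d ≤ n ∧ p = esymm (Fin n) ℚ d}

/-- `S_{n,k} = ℚ[x_1, …, x_n] / J_{n,k}`. -/
abbrev QuotientS (n k : ℕ) : Type := MvPolynomial (Fin n) ℚ ⧸ idealJ n k

/-! ### Lexicographic order and standard monomials -/

/-- The lexicographic monomial order on `x_1, …, x_n` with `x_n > x_{n-1} > ⋯ > x_1`:
exponent vectors are compared at the largest index at which they differ. -/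
noncomputable def lexOrder (n : ℕ) : MonomialOrder (Fin n) where
  syn := Lex ((Fin n)ᵒᵈ →₀ ℕ)
  toSyn := (Finsupp.domCongr (OrderDual.toDual : Fin n ≃ (Fin n)ᵒᵈ)).trans
    { toEquiv := toLex, map_add' := toLex_add }
  toSyn_monotone := fun _ _ h => Finsupp.toLex_monotone fun i => h (OrderDual.ofDual i)

theorem lexOrder_lt_iff {n : ℕ} {a b : Fin n →₀ ℕ} :
    (lexOrder n).toSyn a < (lexOrder n).toSyn b ↔
      ∃ j, (∀ i, j < i → a i = b i) ∧ a j < b j :=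
  Iff.rfl

/-- The ideal `LM(I)` generated by the leading monomials of all nonzero `f ∈ I`. -/
noncomputable def leadingMonomialIdeal {n : ℕ} (m : MonomialOrder (Fin n))
    (I : Ideal (MvPolynomial (Fin n) ℚ)) : Ideal (MvPolynomial (Fin n) ℚ) :=
  Ideal.span {p | ∃ f ∈ I, f ≠ 0 ∧ p = monomial (m.degree f) 1}

/-- The standard monomials of `ℚ[x_1, …, x_n] / I`: the monomials that are not in `LM(I)`. -/
def standardMonomials {n : ℕ} (m : MonomialOrder (Fin n))
    (I : Ideal (MvPolynomial (Fin n) ℚ)) : Set (MvPolynomial (Fin n) ℚ) :=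
  {p | (∃ c : Fin n →₀ ℕ, p = monomial c 1) ∧ p ∉ leadingMonomialIdeal m I}

/-- The monomials `x_1^{c_1} ⋯ x_n^{c_n}` where `(c_1, …, c_n)` is the boosted coinversion code of
some ordered set partition of `[n]` with at least `k` blocks. -/
def codeMonomials (n k : ℕ) : Set (MvPolynomial (Fin n) ℚ) :=
  {p | ∃ (ℓ : ℕ) (σ : OrderedSetPartition n ℓ), k ≤ ℓ ∧ p = ∏ i, X i ^ σ.boostedCode i}

end StdMonomials

namespace StdMonomials

open MvPolynomial

/-! ### Elementary and complete homogeneous symmetric polynomials in subsets of the variables -/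

variable {n : ℕ}

/-! The proof is a sandwich: #points ≤ #standard monomials ≤ #code monomials ≤ #points, where the
points record the block positions of ordered set partitions with at least `k` blocks. The middle
inequality comes from an inclusion, which is therefore an equality.

Inclusion (`standardMonomials_subset`). From an exponent vector `c`, build `A` from the largest
index down, putting `i` in `A` iff `c i` is at most the number of elements of `A` above `i`. Off
`A`, `c` dominates the exponents of the skip monomial of the complement of `A`. By
`exists_degree_eq_skip` a skip monomial of `T ⊆ U` is a leading monomial in any ideal containing all
`e_d(U)` with `d ≥ #T`. If `#A < k`, the generators `e_d` put `x^c` in the leading ideal; if some `c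
i > #A`, the generators `x_i^d e_{n-r}^{(i)}` do. Otherwise `exists_boostedCode_eq` builds a
partition with code `c` whose block minima form `A`.

Lower bound (`ncard_le_of_isTopForm`). Every generator of `J_{n,k}` is the top-degree part of a
polynomial vanishing on the points, so monomials spanning the quotient also span the functions on
the points.

The basis statement then follows from the general fact that standard monomials form a basis. -/

/-- The elementary symmetric polynomial of degree `d` in the variables indexed by `U`. -/
noncomputable def esymmOn (U : Finset (Fin n)) (d : ℕ) : MvPolynomial (Fin n) ℚ :=
  ∑ s ∈ U.powersetCard d, ∏ j ∈ s, X j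

/-- The complete homogeneous symmetric polynomial of degree `d` in the variables indexed by `P`,
up to the sign `(-1) ^ d`. -/
noncomputable def signedHsymm (P : Finset (Fin n)) (d : ℕ) : MvPolynomial (Fin n) ℚ :=
  ∑ l ∈ P.finsuppAntidiag d, monomial l ((-1) ^ d)

theorem esymmOn_zero (U : Finset (Fin n)) : esymmOn U 0 = 1 := by
  simp [esymmOn]

theorem esymmOn_eq_zero {U : Finset (Fin n)} {d : ℕ} (h : U.card < d) : esymmOn U d = 0 := by
  simp [esymmOn, Finset.powersetCard_eq_empty.2 h]

theorem coeff_prod_one_add {A : Type*} [CommRing A] (U : Finset (Fin n)) (f : Fin n → A) (d : ℕ) :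
    PowerSeries.coeff d (∏ i ∈ U, (1 + PowerSeries.C (f i) * PowerSeries.X)) =
      ∑ s ∈ U.powersetCard d, ∏ j ∈ s, f j := by
  rw [Finset.prod_one_add, map_sum, Finset.powersetCard_eq_filter, Finset.sum_filter]
  refine Finset.sum_congr rfl fun s _ => ?_
  rw [Finset.prod_mul_distrib, ← map_prod, Finset.prod_const, PowerSeries.coeff_C_mul,
    PowerSeries.coeff_X_pow]
  simp [eq_comm]

theorem coeff_prod_geom (P : Finset (Fin n)) (d : ℕ) :
    PowerSeries.coeff d (∏ i ∈ P, PowerSeries.mk fun a =>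
      (-X i : MvPolynomial (Fin n) ℚ) ^ a) = signedHsymm P d := by
  rw [PowerSeries.coeff_prod, signedHsymm]
  refine Finset.sum_congr rfl fun l hl => ?_
  obtain ⟨h1, h2⟩ := Finset.mem_finsuppAntidiag.1 hl
  rw [monomial_eq, Finsupp.prod_of_support_subset l h2 _ (by simp), ← h1]
  simp only [PowerSeries.coeff_mk]
  simp_rw [neg_pow (X _ : MvPolynomial (Fin n) ℚ)]
  rw [Finset.prod_mul_distrib, Finset.prod_pow_eq_pow_sum]
  simp

theorem one_add_mul_geom {A : Type*} [CommRing A] (x : A) :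
    (1 + PowerSeries.C x * PowerSeries.X) * (PowerSeries.mk fun a => (-x) ^ a) = 1 := by
  ext d
  cases d with
  | zero => simp
  | succ d =>
    rw [add_mul, one_mul, mul_assoc, map_add, PowerSeries.coeff_C_mul,
      PowerSeries.coeff_succ_X_mul]
    simp [PowerSeries.coeff_one, pow_succ, mul_comm x]

/-- Multiplying `∏_{i ∈ U} (1 + x_i z)` by the inverses of the factors from `P` leaves the product
over `U \ P`, a polynomial in `z` of degree at most `#(U \ P)`; compare coefficients of `z ^ d`. -/
theorem sum_esymmOn_mul_signedHsymm {U P : Finset (Fin n)} (hP : P ⊆ U) {d : ℕ}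
    (hd : (U \ P).card < d) :
    ∑ a ∈ Finset.HasAntidiagonal.antidiagonal d, esymmOn U a.1 * signedHsymm P a.2 = 0 := by
  have h : (∏ i ∈ U, (1 + PowerSeries.C (X i : MvPolynomial (Fin n) ℚ) * PowerSeries.X)) *
      (∏ i ∈ P, PowerSeries.mk fun a => (-X i : MvPolynomial (Fin n) ℚ) ^ a) =
      ∏ i ∈ U \ P, (1 + PowerSeries.C (X i : MvPolynomial (Fin n) ℚ) * PowerSeries.X) := by
    rw [← Finset.prod_sdiff hP, mul_assoc, ← Finset.prod_mul_distrib]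
    simp [one_add_mul_geom]
  have h2 := congrArg (PowerSeries.coeff d) h
  rw [PowerSeries.coeff_mul, coeff_prod_one_add] at h2
  simp only [coeff_prod_one_add, coeff_prod_geom] at h2
  exact h2.trans (esymmOn_eq_zero hd)

theorem signedHsymm_degree_le {P : Finset (Fin n)} {p : Fin n} (hP : ∀ i ∈ P, i ≤ p) (d : ℕ) :
    (lexOrder n).toSyn ((lexOrder n).degree (signedHsymm P d)) ≤
      (lexOrder n).toSyn (Finsupp.single p d) := by
  rw [MonomialOrder.degree_le_iff]
  intro l hl
  obtain ⟨l', hl', hl''⟩ := Finset.mem_biUnion.1 (support_sum hl)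
  obtain rfl : l = l' := by simpa using support_monomial_subset hl''
  obtain ⟨h1, h2⟩ := Finset.mem_finsuppAntidiag'.1 hl'
  have hle : ∀ i, l i ≤ d := fun i => by
    by_cases hi : i ∈ l.support
    · rw [← h1]; exact Finset.single_le_sum (f := fun i => l i) (fun _ _ => Nat.zero_le _) hi
    · simp [Finsupp.notMem_support_iff.1 hi]
  have h0 : ∀ i, p < i → l i = 0 := fun i hi => by
    by_contra hne
    exact absurd (hP i (h2 (Finsupp.mem_support_iff.2 hne))) (not_le.2 hi)
  rcases (hle p).lt_or_eq with h | h
  · refine le_of_lt (lexOrder_lt_iff.2 ⟨p, fun i hi => ?_, by simpa using h⟩)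
    rw [h0 i hi, Finsupp.single_eq_of_ne hi.ne']
  · refine le_of_eq (congrArg _ ?_)
    ext i
    by_cases hi : i = p
    · simp [hi, h]
    rw [Finsupp.single_eq_of_ne hi]
    by_contra hne
    have hi' : i ∈ l.support := Finsupp.mem_support_iff.2 hne
    have h3 : ∑ j ∈ {i, p}, l j ≤ l.sum fun _ x => x := by
      rw [Finsupp.sum_of_support_subset l (Finset.subset_univ _) _ (by simp)]
      exact Finset.sum_le_sum_of_subset (Finset.subset_univ _)
    rw [Finset.sum_pair hi, h1, h] at h3
    omega

theorem coeff_signedHsymm_single {P : Finset (Fin n)} {p : Fin n} (hp : p ∈ P) (d : ℕ) :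
    coeff (Finsupp.single p d) (signedHsymm P d) = (-1) ^ d := by
  rw [signedHsymm, coeff_sum, Finset.sum_eq_single_of_mem (Finsupp.single p d)]
  · simp
  · rw [Finset.mem_finsuppAntidiag']
    refine ⟨by simp, Finsupp.support_single_subset.trans (by simpa using hp)⟩
  · intro l _ hl
    simp [coeff_monomial, hl]

theorem degree_eq_of_coeff_ne_zero {m : MonomialOrder (Fin n)} {f : MvPolynomial (Fin n) ℚ}
    {D : Fin n →₀ ℕ} (h : m.toSyn (m.degree f) ≤ m.toSyn D) (hD : coeff D f ≠ 0) :
    m.degree f = D :=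
  m.toSyn.injective (le_antisymm h (m.le_degree (mem_support_iff.2 hD)))

theorem signedHsymm_degree {P : Finset (Fin n)} {p : Fin n} (hp : p ∈ P) (hP : ∀ i ∈ P, i ≤ p)
    (d : ℕ) : (lexOrder n).degree (signedHsymm P d) = Finsupp.single p d :=
  degree_eq_of_coeff_ne_zero (signedHsymm_degree_le hP d) (by simp [coeff_signedHsymm_single hp])

theorem signedHsymm_ne_zero {P : Finset (Fin n)} {p : Fin n} (hp : p ∈ P) (d : ℕ) :
    signedHsymm P d ≠ 0 := fun h => by
  have := coeff_signedHsymm_single hp d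
  rw [h, coeff_zero] at this
  exact pow_ne_zero d (by norm_num) this.symm

/-! ### Determinants of complete symmetric polynomials and their leading monomials -/

theorem Equiv.Perm.exists_lt_of_ne_one {t : ℕ} {π : Equiv.Perm (Fin t)} (h : π ≠ 1) :
    ∃ p, p < π p ∧ ∀ q < p, π q = q := by
  obtain ⟨p, hp, hmin⟩ := WellFounded.has_min (wellFounded_lt (α := Fin t)) {p | π p ≠ p} (by
    by_contra he
    exact h (Equiv.ext fun p => by_contra fun hp => he ⟨p, hp⟩))
  have hq : ∀ q < p, π q = q := fun q hq => by_contra fun h' => hmin q h' hq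
  refine ⟨p, lt_of_le_of_ne (le_of_not_gt fun hlt => ?_) (Ne.symm hp), hq⟩
  exact hp (π.injective (hq _ hlt))

/-- The matrix whose determinant has a skip monomial as its leading monomial. -/
noncomputable def skipMatrix (U : Finset (Fin n)) {t : ℕ} (τ : Fin t → Fin n) :
    Matrix (Fin t) (Fin t) (MvPolynomial (Fin n) ℚ) := fun j p =>
  if (j : ℕ) ≤ (U.filter (τ p < ·)).card + 1 then
    signedHsymm (U.filter (· ≤ τ p)) ((U.filter (τ p < ·)).card + 1 - j) else 0

theorem skipMatrix_degree_le (U : Finset (Fin n)) {t : ℕ} (τ : Fin t → Fin n) (j p : Fin t) :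
    (lexOrder n).toSyn ((lexOrder n).degree (skipMatrix U τ j p)) ≤
      (lexOrder n).toSyn (Finsupp.single (τ p) ((U.filter (τ p < ·)).card + 1 - j)) := by
  unfold skipMatrix
  split_ifs with h
  · exact signedHsymm_degree_le (fun i hi => (Finset.mem_filter.1 hi).2) _
  · rw [MonomialOrder.degree_zero, map_zero]
    exact bot_le

/-- At the first column `p` moved by `π` one has `π p > p`, which lowers the exponent of `τ p`; the
larger variables `τ q`, `q < p`, keep theirs. The bound `p < d p` keeps truncated subtraction from
hiding the drop. -/
theorem sum_single_lt_of_perm {t : ℕ} {τ : Fin t → Fin n} (hτ : StrictAnti τ) {d : Fin t → ℕ}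
    (hd : ∀ p : Fin t, (p : ℕ) < d p) {π : Equiv.Perm (Fin t)} (hπ : π ≠ 1) :
    (lexOrder n).toSyn (∑ p, Finsupp.single (τ p) (d p - π p)) <
      (lexOrder n).toSyn (∑ p, Finsupp.single (τ p) (d p - p)) := by
  obtain ⟨p, hp, hq⟩ := Equiv.Perm.exists_lt_of_ne_one hπ
  have key : ∀ (g : Fin t → ℕ) (q : Fin t),
      (∑ p, Finsupp.single (τ p) (g p) : Fin n →₀ ℕ) (τ q) = g q := fun g q => by
    rw [Finsupp.finsetSum_apply, Finset.sum_eq_single_of_mem q (Finset.mem_univ _)]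
    · simp
    · intro r _ hr
      rw [Finsupp.single_eq_of_ne]
      exact fun h => hr (hτ.injective h).symm
  refine lexOrder_lt_iff.2 ⟨τ p, fun i hi => ?_, ?_⟩
  · by_cases hr : ∃ q, τ q = i
    · obtain ⟨q, rfl⟩ := hr
      rw [key (fun p => d p - π p), key (fun p => d p - p), hq q (hτ.lt_iff_gt.1 hi)]
    · push Not at hr
      simp only [Finsupp.finsetSum_apply]
      refine Finset.sum_congr rfl fun q _ => ?_
      rw [Finsupp.single_eq_of_ne (hr q).symm, Finsupp.single_eq_of_ne (hr q).symm]
  · rw [key (fun p => d p - π p), key (fun p => d p - p)]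
    have := hd p
    have : (p : ℕ) < π p := hp
    omega

theorem lt_card_filter_of_strictAnti {U : Finset (Fin n)} {t : ℕ} {τ : Fin t → Fin n}
    (hτ : StrictAnti τ) (hU : ∀ p, τ p ∈ U) (p : Fin t) :
    (p : ℕ) < (U.filter (τ p < ·)).card + 1 := by
  have h : (Finset.univ.filter fun q : Fin t => q < p).card ≤ (U.filter (τ p < ·)).card :=
    Finset.card_le_card_of_injOn τ (fun q hq => by
      simp only [Finset.coe_filter, Finset.mem_univ, true_and, Set.mem_ofPred_eq] at hq
      simpa using ⟨hU q, hτ hq⟩) hτ.injective.injOn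
  have h2 : (Finset.univ.filter fun q : Fin t => q < p) = Finset.Iio p := by ext; simp
  rw [h2, Fin.card_Iio] at h
  omega

/-- In the Leibniz expansion every non-identity permutation has a strictly smaller leading monomial
than the diagonal product, so the diagonal term cannot cancel. -/
theorem skipMatrix_det_degree {U : Finset (Fin n)} {t : ℕ} {τ : Fin t → Fin n}
    (hτ : StrictAnti τ) (hU : ∀ p, τ p ∈ U) :
    (skipMatrix U τ).det ≠ 0 ∧ (lexOrder n).degree (skipMatrix U τ).det =
      ∑ p, Finsupp.single (τ p) ((U.filter (τ p < ·)).card + 1 - p) := by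
  set d : Fin t → ℕ := fun p => (U.filter (τ p < ·)).card + 1 with hd
  have hlt : ∀ p : Fin t, (p : ℕ) < d p := lt_card_filter_of_strictAnti hτ hU
  set D : Fin n →₀ ℕ := ∑ p, Finsupp.single (τ p) (d p - p)
  have hterm : ∀ π : Equiv.Perm (Fin t),
      (lexOrder n).toSyn ((lexOrder n).degree (∏ p, skipMatrix U τ (π p) p)) ≤
        (lexOrder n).toSyn (∑ p, Finsupp.single (τ p) (d p - π p)) := fun π => by
    refine (MonomialOrder.degree_prod_le).trans ?_
    rw [map_sum, map_sum]
    exact Finset.sum_le_sum fun p _ => skipMatrix_degree_le U τ (π p) p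
  have hdiag : ∀ p, skipMatrix U τ p p = signedHsymm (U.filter (· ≤ τ p)) (d p - p) := fun p =>
    if_pos (hlt p).le
  have hmem : ∀ p, τ p ∈ U.filter (· ≤ τ p) := fun p => by simp [hU p]
  have hne : ∏ p, skipMatrix U τ p p ≠ 0 := Finset.prod_ne_zero_iff.2 fun p _ => by
    rw [hdiag]; exact signedHsymm_ne_zero (hmem p) _
  have hdeg : (lexOrder n).degree (∏ p, skipMatrix U τ p p) = D := by
    rw [MonomialOrder.degree_prod fun p hp => (Finset.prod_ne_zero_iff.1 hne) p hp]
    refine Finset.sum_congr rfl fun p _ => ?_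
    rw [hdiag]
    exact signedHsymm_degree (hmem p) (fun i hi => (Finset.mem_filter.1 hi).2) _
  have hcoeff : coeff D (skipMatrix U τ).det ≠ 0 := by
    rw [Matrix.det_apply, coeff_sum, Finset.sum_eq_single_of_mem 1 (Finset.mem_univ _)]
    · simp only [Equiv.Perm.sign_one, one_smul, Equiv.Perm.one_apply]
      rw [← hdeg]
      exact (lexOrder n).coeff_degree_ne_zero_iff.2 hne
    · intro π _ hπ
      have h0 : coeff D (∏ p, skipMatrix U τ (π p) p) = 0 :=
        (lexOrder n).coeff_eq_zero_of_lt ((hterm π).trans_lt (sum_single_lt_of_perm hτ hlt hπ))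
      rcases Int.units_eq_one_or (Equiv.Perm.sign π) with h | h <;> simp [h, h0]
  refine ⟨fun h => hcoeff (by rw [h, coeff_zero]), degree_eq_of_coeff_ne_zero ?_ hcoeff⟩
  rw [Matrix.det_apply]
  refine MonomialOrder.degree_sum_le.trans (Finset.sup_le fun π _ => ?_)
  have h1 : (lexOrder n).toSyn ((lexOrder n).degree
      (Equiv.Perm.sign π • ∏ p, skipMatrix U τ (π p) p)) ≤
      (lexOrder n).toSyn (∑ p, Finsupp.single (τ p) (d p - π p)) := by
    rcases Int.units_eq_one_or (Equiv.Perm.sign π) with h | h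
    · simpa [h] using hterm π
    · simpa [h] using hterm π
  refine h1.trans ?_
  by_cases hπ : π = 1
  · simp [hπ, D]
  · exact (sum_single_lt_of_perm hτ hlt hπ).le

/-- Modulo `I` the row vector `(e_0, …, e_{t-1})` is killed by the matrix. Multiplying by the
adjugate shows that the determinant kills `e_0 = 1`. For `t = 0` the hypothesis already puts `1` in
`I`. -/
theorem skipMatrix_det_mem {U : Finset (Fin n)} {t : ℕ} (τ : Fin t → Fin n)
    (I : Ideal (MvPolynomial (Fin n) ℚ)) (hI : ∀ d, t ≤ d → esymmOn U d ∈ I) :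
    (skipMatrix U τ).det ∈ I := by
  rcases Nat.eq_zero_or_pos t with rfl | ht
  · rw [(Ideal.eq_top_iff_one I).2 (esymmOn_zero U ▸ hI 0 le_rfl)]
    trivial
  rw [← Ideal.Quotient.eq_zero_iff_mem, RingHom.map_det]
  set φ := Ideal.Quotient.mk I
  set M := φ.mapMatrix (skipMatrix U τ)
  have hv : Matrix.vecMul (fun j : Fin t => φ (esymmOn U j)) M = 0 := by
    funext p
    set d := (U.filter (τ p < ·)).card + 1 with hd
    have hsd : U \ U.filter (· ≤ τ p) = U.filter (τ p < ·) := by ext i; simp; tauto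
    have hrel := congrArg φ (sum_esymmOn_mul_signedHsymm (d := d)
      (Finset.filter_subset (· ≤ τ p) U) (by rw [hsd]; omega))
    rw [Finset.Nat.sum_antidiagonal_eq_sum_range_succ
      (fun a b => esymmOn U a * signedHsymm (U.filter (· ≤ τ p)) b), map_sum, map_zero] at hrel
    set F : ℕ → MvPolynomial (Fin n) ℚ ⧸ I := fun j => if j ≤ d then
      φ (esymmOn U j * signedHsymm (U.filter (· ≤ τ p)) (d - j)) else 0 with hF
    -- The bounds `t` and `d + 1` are not comparable in general, so both sums are extended to their
    -- maximum: `F` vanishes from `d + 1` on by definition, and from `t` on because `e_j ∈ I`.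
    have h1 : ∀ N, (∀ j, N ≤ j → F j = 0) → ∀ K, N ≤ K →
        ∑ j ∈ Finset.range K, F j = ∑ j ∈ Finset.range N, F j := fun N hN K hK =>
      (Finset.sum_subset (Finset.range_subset_range.2 hK) fun j _ hj =>
        hN j (by simpa using hj)).symm
    have h2 : ∑ j ∈ Finset.range (d + 1), F j = 0 := by
      rw [← hrel]
      exact Finset.sum_congr rfl fun j hj => if_pos (by simpa [Nat.lt_succ_iff] using hj)
    have h3 : ∑ j ∈ Finset.range t, F j = 0 := by
      rw [← h1 t (fun j hj => ?_) (max t (d + 1)) (le_max_left _ _),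
        h1 (d + 1) (fun j hj => if_neg (by omega)) _ (le_max_right _ _), h2]
      simp only [hF]
      split_ifs
      · exact Ideal.Quotient.eq_zero_iff_mem.2 (I.mul_mem_right _ (hI j hj))
      · rfl
    rw [Matrix.vecMul, dotProduct, Pi.zero_apply, ← h3, Finset.sum_range]
    refine Finset.sum_congr rfl fun j _ => ?_
    simp only [hF, M, RingHom.mapMatrix_apply, Matrix.map_apply, skipMatrix, ← hd]
    split_ifs <;> simp
  have h := congrArg (fun v => Matrix.vecMul v M.adjugate) hv
  simp only [Matrix.vecMul_vecMul, Matrix.mul_adjugate, Matrix.vecMul_smul, Matrix.vecMul_one,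
    Matrix.zero_vecMul] at h
  simpa [esymmOn_zero] using congrFun h ⟨0, ht⟩

/-- Skip monomials are leading monomials of elements of `⟨e_d(U) : d ≥ #T⟩`. -/
theorem exists_degree_eq_skip {U T : Finset (Fin n)} (hT : T ⊆ U)
    (I : Ideal (MvPolynomial (Fin n) ℚ)) (hI : ∀ d, T.card ≤ d → esymmOn U d ∈ I) :
    ∃ f ∈ I, f ≠ 0 ∧ (lexOrder n).degree f =
      ∑ i ∈ T, Finsupp.single i (((U \ T).filter (i < ·)).card + 1) := by
  set τ : Fin T.card → Fin n := fun p => T.orderEmbOfFin rfl p.rev with hτdef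
  have hτ : StrictAnti τ := fun p q h =>
    (T.orderEmbOfFin rfl).strictMono (Fin.rev_lt_rev.2 h)
  have hmem : ∀ p, τ p ∈ T := fun p => T.orderEmbOfFin_mem rfl _
  obtain ⟨h0, hdeg⟩ := skipMatrix_det_degree hτ fun p => hT (hmem p)
  refine ⟨_, skipMatrix_det_mem τ I hI, h0, hdeg.trans ?_⟩
  have himg : Finset.univ.image τ = T := by
    refine Finset.eq_of_subset_of_card_le (Finset.image_subset_iff.2 fun p _ => hmem p) ?_
    rw [Finset.card_image_of_injective _ hτ.injective]
    simp
  have hs : ∀ g : Fin n → Fin n →₀ ℕ, ∑ i ∈ T, g i = ∑ p, g (τ p) := fun g => by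
    rw [← Finset.sum_image hτ.injective.injOn, himg]
  rw [hs]
  refine Finset.sum_congr rfl fun p _ => congrArg _ ?_
  -- Since `τ` lists `T` in decreasing order, exactly `p` elements of `T` exceed `τ p`; subtracting
  -- `p` leaves the count over `U \ T`.
  have h1 : T.filter (τ p < ·) = (Finset.Iio p).image τ := by
    ext i
    simp only [Finset.mem_filter, Finset.mem_image, Finset.mem_Iio]
    constructor
    · rintro ⟨hi, hlt⟩
      obtain ⟨q, -, rfl⟩ := Finset.mem_image.1 (himg ▸ hi)
      exact ⟨q, hτ.lt_iff_gt.1 hlt, rfl⟩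
    · rintro ⟨q, hq, rfl⟩
      exact ⟨hmem q, hτ hq⟩
  have h2 : (T.filter (τ p < ·)).card = p := by
    rw [h1, Finset.card_image_of_injective _ hτ.injective, Fin.card_Iio]
  have h3 : (U.filter (τ p < ·)).card =
      ((U \ T).filter (τ p < ·)).card + (T.filter (τ p < ·)).card := by
    rw [← Finset.card_union_of_disjoint
      (Finset.disjoint_filter_filter Finset.sdiff_disjoint), ← Finset.filter_union,
      Finset.sdiff_union_of_subset hT]
  omega

/-! ### Standard monomials form a basis -/

theorem monomial_mem_leadingMonomialIdeal_iff {m : MonomialOrder (Fin n)}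
    {I : Ideal (MvPolynomial (Fin n) ℚ)} {c : Fin n →₀ ℕ} :
    monomial c 1 ∈ leadingMonomialIdeal m I ↔ ∃ f ∈ I, f ≠ 0 ∧ m.degree f ≤ c := by
  have h : {p : MvPolynomial (Fin n) ℚ | ∃ f ∈ I, f ≠ 0 ∧ p = monomial (m.degree f) 1} =
      (fun s => monomial s (1 : ℚ)) '' {s | ∃ f ∈ I, f ≠ 0 ∧ m.degree f = s} := by
    ext p
    constructor
    · rintro ⟨f, hf, h0, rfl⟩
      exact ⟨_, ⟨f, hf, h0, rfl⟩, rfl⟩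
    · rintro ⟨_, ⟨f, hf, h0, rfl⟩, rfl⟩
      exact ⟨f, hf, h0, rfl⟩
  rw [leadingMonomialIdeal, h, mem_ideal_span_monomial_image]
  simp [support_monomial, and_assoc]

/-- Divide by all nonzero elements of `I` at once: no monomial of the remainder is divisible by a
leading monomial of `I`. -/
theorem exists_sub_mem_of_standard (m : MonomialOrder (Fin n))
    (I : Ideal (MvPolynomial (Fin n) ℚ)) (p : MvPolynomial (Fin n) ℚ) :
    ∃ r ∈ Submodule.span ℚ (standardMonomials m I), p - r ∈ I := by
  obtain ⟨g, r, hp, -, hr⟩ := m.div_set (B := {f | f ∈ I ∧ f ≠ 0})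
    (fun f hf => isUnit_iff_ne_zero.2 (m.leadingCoeff_ne_zero_iff.2 hf.2)) p
  refine ⟨r, ?_, ?_⟩
  · rw [r.as_sum]
    refine Submodule.sum_mem _ fun c hc => ?_
    rw [← mul_one (coeff c r), ← smul_eq_mul, ← smul_monomial]
    refine Submodule.smul_mem _ _ (Submodule.subset_span ⟨⟨c, rfl⟩, fun hmem => ?_⟩)
    obtain ⟨f, hf, h0, hle⟩ := monomial_mem_leadingMonomialIdeal_iff.1 hmem
    exact hr c hc f ⟨hf, h0⟩ hle
  · rw [hp, add_sub_cancel_right, Finsupp.linearCombination_apply]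
    exact Ideal.sum_mem _ fun f _ => I.mul_mem_left _ f.2.1

theorem disjoint_span_standardMonomials (m : MonomialOrder (Fin n))
    (I : Ideal (MvPolynomial (Fin n) ℚ)) {r : MvPolynomial (Fin n) ℚ}
    (hr : r ∈ Submodule.span ℚ (standardMonomials m I)) (hI : r ∈ I) : r = 0 := by
  have hle : Submodule.span ℚ (standardMonomials m I) ≤
      restrictSupport ℚ {c | monomial c (1 : ℚ) ∉ leadingMonomialIdeal m I} := by
    refine Submodule.span_le.2 ?_
    rintro _ ⟨⟨c, rfl⟩, hc⟩
    rw [SetLike.mem_coe, mem_restrictSupport_iff]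
    intro d hd
    obtain rfl : d = c := by simpa using support_monomial_subset hd
    exact hc
  by_contra h0
  exact hle hr (m.degree_mem_support h0)
    (monomial_mem_leadingMonomialIdeal_iff.2 ⟨r, hI, h0, le_rfl⟩)

theorem exists_basis_standardMonomials (m : MonomialOrder (Fin n))
    (I : Ideal (MvPolynomial (Fin n) ℚ)) :
    ∃ b : Module.Basis (standardMonomials m I) ℚ (MvPolynomial (Fin n) ℚ ⧸ I),
      ∀ p, b p = Ideal.Quotient.mk I (p : MvPolynomial (Fin n) ℚ) := by
  set φ : MvPolynomial (Fin n) ℚ →ₗ[ℚ] MvPolynomial (Fin n) ℚ ⧸ I :=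
    (Ideal.Quotient.mkₐ ℚ I).toLinearMap with hφ
  have hli : LinearIndependent ℚ
      (fun p : standardMonomials m I => (p : MvPolynomial (Fin n) ℚ)) := by
    have h := (basisMonomials (Fin n) ℚ).linearIndependent.linearIndepOn_id
    refine h.mono ?_
    rintro _ ⟨⟨c, rfl⟩, -⟩
    exact ⟨c, by simp⟩
  have hker : Disjoint (Submodule.span ℚ (Set.range
      fun p : standardMonomials m I => (p : MvPolynomial (Fin n) ℚ))) (LinearMap.ker φ) := by
    rw [Subtype.range_coe, Submodule.disjoint_def]
    exact fun r hr hI => disjoint_span_standardMonomials m I hr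
      (Ideal.Quotient.eq_zero_iff_mem.1 hI)
  refine ⟨Module.Basis.mk (hli.map hker) ?_, fun p => by rw [Module.Basis.mk_apply]; rfl⟩
  rintro x -
  obtain ⟨p, rfl⟩ := Ideal.Quotient.mk_surjective x
  obtain ⟨r, hr, hpr⟩ := exists_sub_mem_of_standard m I p
  rw [Set.range_comp, Subtype.range_coe, ← Submodule.map_span]
  exact ⟨r, hr, (Ideal.Quotient.eq.2 hpr).symm⟩

/-! ### Orbit harmonics -/

/-- `g` is homogeneous of degree `e`, and `q - g` has degree less than `e`. -/
def IsTopForm (e : ℕ) (q g : MvPolynomial (Fin n) ℚ) : Prop :=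
  g.IsHomogeneous e ∧ ∀ c, e ≤ c.degree → coeff c q = coeff c g

theorem IsTopForm.mul {e e' : ℕ} {q q' g g' : MvPolynomial (Fin n) ℚ} (h : IsTopForm e q g)
    (h' : IsTopForm e' q' g') : IsTopForm (e + e') (q * q') (g * g') := by
  refine ⟨h.1.mul h'.1, fun c hc => ?_⟩
  rw [coeff_mul, coeff_mul]
  refine Finset.sum_congr rfl fun a ha => ?_
  have hdeg : a.1.degree + a.2.degree = c.degree := by
    rw [← Finset.HasAntidiagonal.mem_antidiagonal.1 ha, map_add]
  have hz : ∀ {e} {q g : MvPolynomial (Fin n) ℚ}, IsTopForm e q g → ∀ c, e < c.degree →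
      coeff c q = 0 ∧ coeff c g = 0 := fun hq c hc =>
    ⟨(hq.2 c hc.le).trans (hq.1.coeff_eq_zero hc.ne'), hq.1.coeff_eq_zero hc.ne'⟩
  rcases lt_trichotomy a.1.degree e with h1 | h1 | h1
  · simp [hz h' a.2 (by omega)]
  · rw [h.2 _ h1.ge, h'.2 _ (by omega)]
  · simp [hz h a.1 h1]

theorem IsTopForm.of_sub {e : ℕ} {q g : MvPolynomial (Fin n) ℚ} (h : g.IsHomogeneous e)
    (hq : ∀ c, e ≤ c.degree → coeff c (q - g) = 0) : IsTopForm e q g :=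
  ⟨h, fun c hc => sub_eq_zero.1 ((MvPolynomial.coeff_sub _ c q g).symm.trans (hq c hc))⟩

theorem isTopForm_prod_X_sub_C (i : Fin n) (d : ℕ) (a : ℕ → ℚ) :
    IsTopForm d (∏ m ∈ Finset.range d, (X i - C (a m))) (X i ^ d) := by
  induction d with
  | zero => exact ⟨by simpa using isHomogeneous_one _ _, fun c _ => by simp⟩
  | succ d ih =>
    rw [Finset.prod_range_succ, pow_succ]
    refine ih.mul (.of_sub (isHomogeneous_X _ _) fun c hc => ?_)
    have : c ≠ 0 := by rintro rfl; simp at hc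
    simp [coeff_C, this.symm]

/-- Each homogeneous component of `p` is the top component of a polynomial vanishing on `Y`. -/
def HasVanishingTops (Y : Set (Fin n → ℚ)) (p : MvPolynomial (Fin n) ℚ) : Prop :=
  ∀ D, ∃ q, (∀ y ∈ Y, eval y q = 0) ∧ (∀ c, D < c.degree → coeff c q = 0) ∧
    ∀ c, c.degree = D → coeff c q = coeff c p

theorem HasVanishingTops.add {Y : Set (Fin n → ℚ)} {p p' : MvPolynomial (Fin n) ℚ}
    (hp : HasVanishingTops Y p) (hp' : HasVanishingTops Y p') :
    HasVanishingTops Y (p + p') := fun D => by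
  obtain ⟨q, h1, h2, h3⟩ := hp D
  obtain ⟨q', h1', h2', h3'⟩ := hp' D
  refine ⟨q + q', fun z hz => by simp [h1 z hz, h1' z hz], fun c hc => ?_, fun c hc => ?_⟩
  · simp [h2 c hc, h2' c hc]
  · simp [h3 c hc, h3' c hc]

theorem degree_sub_single_add_one {c : Fin n →₀ ℕ} {i : Fin n} (hi : i ∈ c.support) :
    (c - Finsupp.single i 1).degree + 1 = c.degree := by
  have h : c - Finsupp.single i 1 + Finsupp.single i 1 = c :=
    tsub_add_cancel_of_le (Finsupp.single_le_iff.2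
      (Nat.one_le_iff_ne_zero.2 (Finsupp.mem_support_iff.1 hi)))
  conv_rhs => rw [← h]
  simp

theorem HasVanishingTops.X_mul {Y : Set (Fin n → ℚ)} {p : MvPolynomial (Fin n) ℚ}
    (hp : HasVanishingTops Y p) (i : Fin n) : HasVanishingTops Y (X i * p) := fun D => by
  cases D with
  | zero =>
    refine ⟨0, by simp, by simp, fun c hc => ?_⟩
    rw [coeff_zero, coeff_X_mul', if_neg]
    intro hi
    have := degree_sub_single_add_one hi
    omega
  | succ D =>
    obtain ⟨q, h1, h2, h3⟩ := hp D
    refine ⟨X i * q, fun z hz => by simp [h1 z hz], fun c hc => ?_, fun c hc => ?_⟩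
    · rw [coeff_X_mul']
      split_ifs with hi
      · have := degree_sub_single_add_one hi
        exact h2 _ (by omega)
      · rfl
    · rw [coeff_X_mul', coeff_X_mul']
      split_ifs with hi
      · have := degree_sub_single_add_one hi
        exact h3 _ (by omega)
      · rfl

/-- The property passes to sums, scalar multiples and products with a variable, hence from
generators to the ideal. For a homogeneous generator, `q = 0` serves in every degree but its own. -/
theorem hasVanishingTops_of_mem_span {Y : Set (Fin n → ℚ)} {G : Set (MvPolynomial (Fin n) ℚ)}
    (hG : ∀ g ∈ G, ∃ e q, IsTopForm e q g ∧ ∀ y ∈ Y, eval y q = 0)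
    {p : MvPolynomial (Fin n) ℚ} (hp : p ∈ Ideal.span G) : HasVanishingTops Y p := by
  refine Submodule.span_induction (p := fun p _ => HasVanishingTops Y p) ?_ ?_ ?_ ?_ hp
  · intro g hg D
    obtain ⟨e, q, hq, h0⟩ := hG g hg
    by_cases hD : D = e
    · subst hD
      exact ⟨q, h0, fun c hc => (hq.2 c hc.le).trans (hq.1.coeff_eq_zero hc.ne'),
        fun c hc => hq.2 c hc.ge⟩
    · exact ⟨0, by simp, by simp, fun c hc =>
        (hq.1.coeff_eq_zero (fun h => hD (hc.symm.trans h))).symm ▸ coeff_zero c⟩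
  · exact fun D => ⟨0, by simp⟩
  · exact fun x y _ _ hx hy => hx.add hy
  · intro a x _ hx
    induction a using MvPolynomial.induction_on with
    | C a =>
      intro D
      obtain ⟨q, h1, h2, h3⟩ := hx D
      exact ⟨C a * q, fun z hz => by simp [h1 z hz], fun c hc => by simp [h2 c hc],
        fun c hc => by simp [h3 c hc]⟩
    | add f g hf hg => rw [add_smul]; exact hf.add hg
    | mul_X f i hf => rw [mul_comm, mul_smul]; exact hf.X_mul i

theorem exists_eval_eq {Y : Set (Fin n → ℚ)} (hY : Y.Finite) (y : Fin n → ℚ) :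
    ∃ p : MvPolynomial (Fin n) ℚ, eval y p = 1 ∧ ∀ z ∈ Y, z ≠ y → eval z p = 0 := by
  have h : ∀ z : Fin n → ℚ, ∃ p : MvPolynomial (Fin n) ℚ, eval y p = 1 ∧
      (z ≠ y → eval z p = 0) := fun z => by
    by_cases hz : z = y
    · exact ⟨1, by simp, fun h => absurd hz h⟩
    · obtain ⟨i, hi⟩ := Function.ne_iff.1 hz
      refine ⟨C (y i - z i)⁻¹ * (X i - C (z i)), ?_, fun _ => by simp⟩
      simp [inv_mul_cancel₀ (sub_ne_zero.2 (Ne.symm hi))]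
  choose p hp hp' using h
  refine ⟨∏ z ∈ hY.toFinset, p z, by simp [map_prod, hp], fun z hz hzy => ?_⟩
  rw [map_prod]
  exact Finset.prod_eq_zero (hY.mem_toFinset.2 hz) (hp' z hzy)

/-- By interpolation every function on `Y` is a polynomial function, and induction on the degree
bound reduces it to a combination of `S` restricted to `Y`. Hence `S` has at least `dim (Y → ℚ) =
#Y` elements. -/
theorem ncard_le_of_isTopForm {Y : Set (Fin n → ℚ)} (hY : Y.Finite)
    {G : Set (MvPolynomial (Fin n) ℚ)}
    (hG : ∀ g ∈ G, ∃ e q, IsTopForm e q g ∧ ∀ y ∈ Y, eval y q = 0)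
    {S : Set (MvPolynomial (Fin n) ℚ)} (hS : S.Finite) (hmon : ∀ s ∈ S, ∃ c, s = monomial c 1)
    (hspan : ∀ p, ∃ r ∈ Submodule.span ℚ S, p - r ∈ Ideal.span G) :
    Y.ncard ≤ S.ncard := by
  have := hY.fintype
  set ev : MvPolynomial (Fin n) ℚ →ₗ[ℚ] (Y → ℚ) :=
    LinearMap.pi fun y => (aeval (y : Fin n → ℚ)).toLinearMap with hev
  have hev' : ∀ p y, ev p y = eval (y : Fin n → ℚ) p := fun p y => by
    simp [hev, aeval_eq_eval]
  have key : ∀ D p, (∀ c : Fin n →₀ ℕ, D ≤ c.degree → coeff c p = 0) →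
      ev p ∈ (Submodule.span ℚ S).map ev := by
    intro D
    induction D with
    | zero =>
      intro p hp
      rw [(MvPolynomial.ext p 0 fun c => by simpa using hp c (Nat.zero_le _)), map_zero]
      exact Submodule.zero_mem _
    | succ D ih =>
      intro p hp
      obtain ⟨r, hr, hpr⟩ := hspan p
      obtain ⟨q, h1, h2, h3⟩ := hasVanishingTops_of_mem_span hG hpr D
      -- As `S` consists of monomials, its span is stable under taking homogeneous components.
      have hr' : homogeneousComponent D r ∈ Submodule.span ℚ S := by
        refine (Submodule.span_le (p := (Submodule.span ℚ S).comap (homogeneousComponent D))).2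
          (fun s hs => ?_) hr
        obtain ⟨c, rfl⟩ := hmon s hs
        have hc : (monomial c (1 : ℚ)).IsHomogeneous c.degree := isHomogeneous_monomial _ rfl
        rw [SetLike.mem_coe, Submodule.mem_comap, homogeneousComponent_of_mem hc]
        split_ifs
        · exact Submodule.subset_span hs
        · exact Submodule.zero_mem _
      have hq : ev q = 0 := by
        funext y
        rw [hev', h1 _ y.2, Pi.zero_apply]
      -- In degree `D`, `q` agrees with `p - r`, so subtracting it and the degree-`D` part of `r`
      -- cancels the top of `p`; and `q` is invisible on `Y`.
      have hcoeff : ∀ c : Fin n →₀ ℕ, D ≤ c.degree →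
          coeff c (p - homogeneousComponent D r - q) = 0 := fun c hc => by
        rw [MvPolynomial.coeff_sub, MvPolynomial.coeff_sub, coeff_homogeneousComponent]
        rcases hc.eq_or_lt with h | h
        · rw [if_pos h.symm, h3 c h.symm, MvPolynomial.coeff_sub, sub_self]
        · rw [if_neg h.ne', h2 c h, hp c h, sub_zero, sub_zero]
      have hsub := ih _ hcoeff
      have := Submodule.add_mem _ hsub (Submodule.mem_map_of_mem (f := ev) hr')
      simpa [hq] using this
  have htop : (Submodule.span ℚ S).map ev = ⊤ := by
    refine eq_top_iff.2 fun f _ => ?_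
    choose p hp hp' using exists_eval_eq hY
    have hf : ev (∑ y : Y, C (f y) * p y) = f := funext fun z => by
      rw [hev', map_sum, Finset.sum_eq_single_of_mem z (Finset.mem_univ _)]
      · simp [hp]
      · intro y _ hy
        rw [map_mul, hp' y z z.2 (fun h => hy (Subtype.ext h.symm)), mul_zero]
    set P := ∑ y : Y, C (f y) * p y
    rw [← hf]
    refine key (P.totalDegree + 1) P fun c hc => ?_
    by_contra hne
    have : c.degree ≤ P.totalDegree := le_totalDegree (mem_support_iff.2 hne)
    omega
  rw [Submodule.map_span] at htop
  have := (hS.image ev).fintype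
  have h1 := finrank_span_le_card (R := ℚ) (ev '' S)
  rw [htop, finrank_top, Module.finrank_fintype_fun_eq_card, ← Set.ncard_eq_toFinset_card'] at h1
  rw [Set.ncard_eq_toFinset_card', Set.toFinset_card]
  exact h1.trans (Set.ncard_image_le hS)

/-! ### The point set of ordered set partitions -/

/-- The coefficient of `z ^ b` in `∏_{m < d} (1 + m z)⁻¹`. -/
noncomputable def invCoeff (d b : ℕ) : ℚ :=
  PowerSeries.coeff b (∏ m ∈ Finset.range d, PowerSeries.mk fun a => (-(m : ℚ)) ^ a)

theorem invCoeff_zero (d : ℕ) : invCoeff d 0 = 1 := by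
  simp [invCoeff, map_prod]

/-- The coefficient of `z ^ N` in `∏_{j ∈ U} (1 + x_j z) * ∏_{m < d} (1 + m z)⁻¹`. -/
noncomputable def perturbedEsymm (U : Finset (Fin n)) (d N : ℕ) : MvPolynomial (Fin n) ℚ :=
  ∑ a ∈ Finset.HasAntidiagonal.antidiagonal N, esymmOn U a.1 * C (invCoeff d a.2)

theorem esymmOn_isHomogeneous (U : Finset (Fin n)) (d : ℕ) : (esymmOn U d).IsHomogeneous d := by
  refine IsHomogeneous.sum _ _ _ fun s hs => ?_
  have h := IsHomogeneous.prod s (fun j => (X j : MvPolynomial (Fin n) ℚ)) (fun _ => 1)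
    fun j _ => isHomogeneous_X _ _
  simpa [(Finset.mem_powersetCard.1 hs).2] using h

theorem isTopForm_perturbedEsymm (U : Finset (Fin n)) (d N : ℕ) :
    IsTopForm N (perturbedEsymm U d N) (esymmOn U N) := by
  refine ⟨esymmOn_isHomogeneous U N, fun c hc => ?_⟩
  rw [perturbedEsymm, coeff_sum, Finset.sum_eq_single_of_mem (N, 0) (by simp)]
  · simp [invCoeff_zero]
  · rintro ⟨a, b⟩ hab hne
    have hab' : a + b = N := Finset.HasAntidiagonal.mem_antidiagonal.1 hab
    have hlt : a < N := by
      rcases Nat.eq_zero_or_pos b with rfl | hb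
      · exact absurd (by simpa using hab') hne
      · omega
    rw [mul_comm, coeff_C_mul, (esymmOn_isHomogeneous U a).coeff_eq_zero (by omega), mul_zero]

/-- The values `0, …, d - 1` occur among the `y j`, `j ∈ U`, so the inverse factors cancel `d`
factors of `∏ (1 + y_j z)`, leaving degree at most `#U - d < N`. -/
theorem eval_perturbedEsymm {U : Finset (Fin n)} {d N : ℕ} {y : Fin n → ℚ}
    (hy : ∀ m < d, ∃ j ∈ U, y j = m) (hN : U.card < d + N) :
    eval y (perturbedEsymm U d N) = 0 := by
  have hy' : ∀ m : Fin d, ∃ j ∈ U, y j = (m : ℕ) := fun m => hy m m.2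
  choose j hjU hj using hy'
  have hinj : Function.Injective j := fun a b h => by
    have := hj a
    rw [h, hj b] at this
    exact Fin.ext (by exact_mod_cast this.symm)
  set P := Finset.univ.image j
  have hPU : P ⊆ U := Finset.image_subset_iff.2 fun m _ => hjU m
  have hP : P.card = d := by rw [Finset.card_image_of_injective _ hinj]; simp
  have h1 : ∏ i ∈ P, (1 + PowerSeries.C (y i) * PowerSeries.X) =
      ∏ m ∈ Finset.range d, (1 + PowerSeries.C (m : ℚ) * PowerSeries.X) := by
    rw [Finset.prod_image hinj.injOn, Finset.prod_range]
    exact Finset.prod_congr rfl fun m _ => by rw [hj]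
  have h2 : (∏ i ∈ U, (1 + PowerSeries.C (y i) * PowerSeries.X)) *
      (∏ m ∈ Finset.range d, PowerSeries.mk fun a => (-(m : ℚ)) ^ a) =
      ∏ i ∈ U \ P, (1 + PowerSeries.C (y i) * PowerSeries.X) := by
    rw [← Finset.prod_sdiff hPU, mul_assoc, h1, ← Finset.prod_mul_distrib,
      Finset.prod_eq_one (s := Finset.range d) fun m _ => one_add_mul_geom _, mul_one]
  have h3 := congrArg (PowerSeries.coeff N) h2
  rw [PowerSeries.coeff_mul, coeff_prod_one_add, Finset.powersetCard_eq_empty.2 (by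
    have := Finset.card_le_card hPU
    rw [Finset.card_sdiff_of_subset hPU]
    omega), Finset.sum_empty] at h3
  rw [← h3, perturbedEsymm, map_sum]
  refine Finset.sum_congr rfl fun a _ => ?_
  rw [coeff_prod_one_add, map_mul, eval_C, invCoeff, esymmOn, map_sum]
  simp [map_prod]

/-- The point of `ℚ^n` whose coordinates are the block positions of `σ`. -/
noncomputable def OrderedSetPartition.point {ℓ : ℕ} (σ : OrderedSetPartition n ℓ) : Fin n → ℚ :=
  fun i => (σ.blockIndex i : ℕ)

/-- The points of all ordered set partitions with at least `k` blocks. -/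
def partitionPoints (n k : ℕ) : Set (Fin n → ℚ) :=
  {y | ∃ (ℓ : ℕ) (σ : OrderedSetPartition n ℓ), k ≤ ℓ ∧ y = σ.point}

theorem OrderedSetPartition.exists_point_eq {ℓ : ℕ} (σ : OrderedSetPartition n ℓ) {m : ℕ}
    (hm : m < ℓ) : ∃ j, σ.point j = m := by
  obtain ⟨j, hj⟩ := σ.block_nonempty ⟨m, hm⟩
  exact ⟨j, by rw [point, σ.blockIndex_eq hj]⟩

theorem OrderedSetPartition.length_le {ℓ : ℕ} (σ : OrderedSetPartition n ℓ) : ℓ ≤ n := by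
  have h : Function.Surjective σ.blockIndex := fun j => by
    obtain ⟨i, hi⟩ := σ.block_nonempty j
    exact ⟨i, σ.blockIndex_eq hi⟩
  simpa using Fintype.card_le_of_surjective _ h

theorem partitionPoints_finite (n k : ℕ) : (partitionPoints n k).Finite := by
  refine (Set.Finite.pi' fun _ : Fin n =>
    (Set.finite_Iio n).image fun m : ℕ => (m : ℚ)).subset ?_
  rintro _ ⟨ℓ, σ, -, rfl⟩ i
  exact ⟨_, (σ.blockIndex i).2.trans_le σ.length_le, rfl⟩

/-- The generators of `J_{n,k}`. -/
def idealJGenerators (n k : ℕ) : Set (MvPolynomial (Fin n) ℚ) :=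
  {p | ∃ (i : Fin n) (d r : ℕ), 1 ≤ r ∧ r ≤ d ∧ r ≤ n ∧ p = X i ^ d * esymmOmit n i (n - r)} ∪
    {p | ∃ d : ℕ, n + 1 ≤ d + k ∧ d ≤ n ∧ p = esymm (Fin n) ℚ d}

theorem idealJ_eq_span (n k : ℕ) : idealJ n k = Ideal.span (idealJGenerators n k) :=
  (Ideal.span_union _ _).symm

theorem exists_isTopForm_of_mem_generators {k : ℕ} {g : MvPolynomial (Fin n) ℚ}
    (hg : g ∈ idealJGenerators n k) :
    ∃ e q, IsTopForm e q g ∧ ∀ y ∈ partitionPoints n k, eval y q = 0 := by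
  rcases hg with ⟨i, d, r, hr, hrd, hrn, rfl⟩ | ⟨d, hd, hdn, rfl⟩
  · refine ⟨_, _, (isTopForm_prod_X_sub_C i d fun m => m).mul
      (isTopForm_perturbedEsymm (Finset.univ.erase i) d (n - r)), ?_⟩
    rintro _ ⟨ℓ, σ, hk, rfl⟩
    rw [map_mul, mul_eq_zero]
    -- Either the position of `i` is a root of `∏_{m < d} (x_i - m)`, or the positions `0, …, d - 1`
    -- are all filled by elements other than `i`.
    by_cases h : (σ.blockIndex i : ℕ) < d
    · left
      rw [map_prod]
      refine Finset.prod_eq_zero (Finset.mem_range.2 h) ?_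
      simp [OrderedSetPartition.point]
    · right
      refine eval_perturbedEsymm (fun m hm => ?_) ?_
      · obtain ⟨j, hj⟩ := σ.exists_point_eq (m := m) (by have := (σ.blockIndex i).2; omega)
        refine ⟨j, Finset.mem_erase.2 ⟨?_, Finset.mem_univ _⟩, hj⟩
        rintro rfl
        have : (σ.blockIndex j : ℕ) = m := by simpa [OrderedSetPartition.point] using hj
        omega
      · rw [Finset.card_erase_of_mem (Finset.mem_univ _), Finset.card_univ, Fintype.card_fin]
        have := i.pos
        omega
  · refine ⟨_, _, isTopForm_perturbedEsymm Finset.univ k d, ?_⟩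
    rintro _ ⟨ℓ, σ, hk, rfl⟩
    refine eval_perturbedEsymm (fun m hm => ?_) (by simp; omega)
    obtain ⟨j, hj⟩ := σ.exists_point_eq (m := m) (by omega)
    exact ⟨j, Finset.mem_univ _, hj⟩

/-! ### Comparing the number of codes with the number of points -/

theorem OrderedSetPartition.boostedCode_eq_of_point_eq {ℓ ℓ' : ℕ} (σ : OrderedSetPartition n ℓ)
    (σ' : OrderedSetPartition n ℓ') (h : σ.point = σ'.point) : σ.boostedCode = σ'.boostedCode := by
  have hidx : ∀ i, (σ.blockIndex i : ℕ) = σ'.blockIndex i := fun i => by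
    have := congrFun h i
    simpa [point] using this
  have hle : ∀ {a b : ℕ} (τ : OrderedSetPartition n a) (τ' : OrderedSetPartition n b),
      (∀ i, (τ.blockIndex i : ℕ) = τ'.blockIndex i) → a ≤ b := fun {a b} τ τ' hτ => by
    by_contra! hlt
    obtain ⟨i, hi⟩ := τ.block_nonempty ⟨b, hlt⟩
    have h1 := hτ i
    rw [τ.blockIndex_eq hi] at h1
    exact absurd h1.symm (τ'.blockIndex i).2.ne
  obtain rfl : ℓ = ℓ' := le_antisymm (hle σ σ' hidx) (hle σ' σ fun i => (hidx i).symm)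
  have hmem : ∀ (τ : OrderedSetPartition n ℓ) i j, i ∈ τ.block j ↔ τ.blockIndex i = j :=
    fun τ i j => ⟨τ.blockIndex_eq, fun h => h ▸ τ.mem_block_blockIndex i⟩
  have hblock : σ.block = σ'.block := by
    ext j i
    rw [hmem, hmem, Fin.ext (hidx i)]
  have : σ = σ' := by
    cases σ; cases σ'; congr
  rw [this]

/-- Choose one partition for each code monomial and send it to its point. A point determines its
partition, hence its code, so injectivity of the code map itself is not needed here. -/
theorem exists_injOn_codeMonomials (n k : ℕ) :
    ∃ f : MvPolynomial (Fin n) ℚ → Fin n → ℚ,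
      Set.MapsTo f (codeMonomials n k) (partitionPoints n k) ∧
        Set.InjOn f (codeMonomials n k) := by
  have h : ∀ p : MvPolynomial (Fin n) ℚ, ∃ y, p ∈ codeMonomials n k →
      ∃ (ℓ : ℕ) (σ : OrderedSetPartition n ℓ), k ≤ ℓ ∧ y = σ.point ∧
        p = ∏ i, X i ^ σ.boostedCode i := fun p => by
    by_cases hp : p ∈ codeMonomials n k
    · obtain ⟨ℓ, σ, hk, hp'⟩ := hp
      exact ⟨_, fun _ => ⟨ℓ, σ, hk, rfl, hp'⟩⟩
    · exact ⟨0, fun h => absurd h hp⟩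
  choose f hf using h
  refine ⟨f, fun p hp => ?_, fun p hp q hq hpq => ?_⟩
  · obtain ⟨ℓ, σ, hk, hy, -⟩ := hf p hp
    exact ⟨ℓ, σ, hk, hy⟩
  · obtain ⟨ℓ, σ, -, hy, hp'⟩ := hf p hp
    obtain ⟨ℓ', σ', -, hy', hq'⟩ := hf q hq
    rw [hp', hq', σ.boostedCode_eq_of_point_eq σ' (hy.symm.trans (hpq.trans hy'))]

theorem codeMonomials_finite (n k : ℕ) : (codeMonomials n k).Finite := by
  obtain ⟨f, hf, hinj⟩ := exists_injOn_codeMonomials n k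
  exact Set.Finite.of_injOn hf hinj (partitionPoints_finite n k)

theorem ncard_codeMonomials_le (n k : ℕ) :
    (codeMonomials n k).ncard ≤ (partitionPoints n k).ncard := by
  obtain ⟨f, hf, hinj⟩ := exists_injOn_codeMonomials n k
  exact Set.ncard_le_ncard_of_injOn f hf hinj (partitionPoints_finite n k)

theorem standardMonomials_eq_of_subset {k : ℕ} (m : MonomialOrder (Fin n))
    (h : standardMonomials m (idealJ n k) ⊆ codeMonomials n k) :
    standardMonomials m (idealJ n k) = codeMonomials n k := by
  refine Set.eq_of_subset_of_ncard_le h ?_ (codeMonomials_finite n k)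
  refine (ncard_codeMonomials_le n k).trans (ncard_le_of_isTopForm (partitionPoints_finite n k)
    (fun g hg => exists_isTopForm_of_mem_generators hg) ((codeMonomials_finite n k).subset h)
    (fun s hs => hs.1) fun p => ?_)
  rw [← idealJ_eq_span]
  exact exists_sub_mem_of_standard m _ p

/-! ### Monomials that are not codes are leading monomials -/

theorem esymmOn_univ_mem_idealJ {k d : ℕ} (h : n + 1 ≤ d + k) :
    esymmOn Finset.univ d ∈ idealJ n k := by
  by_cases hd : d ≤ n
  · rw [idealJ_eq_span]
    exact Ideal.subset_span (Or.inr ⟨d, h, hd, rfl⟩)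
  · rw [esymmOn_eq_zero (by simpa using hd)]
    exact Ideal.zero_mem _

theorem X_pow_mul_esymmOn_mem_idealJ (k : ℕ) {d e : ℕ} (i : Fin n) (h : n ≤ e + d) :
    X i ^ d * esymmOn (Finset.univ.erase i) e ∈ idealJ n k := by
  by_cases he : n ≤ e
  · rw [esymmOn_eq_zero, mul_zero]
    · exact Ideal.zero_mem _
    · have := i.pos
      simp
      omega
  · rw [idealJ_eq_span]
    refine Ideal.subset_span (Or.inl ⟨i, d, n - e, by omega, by omega, by omega, ?_⟩)
    rw [Nat.sub_sub_self (by omega)]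
    rfl

theorem sum_single_apply (T : Finset (Fin n)) (g : Fin n → ℕ) (i : Fin n) :
    (∑ j ∈ T, Finsupp.single j (g j) : Fin n →₀ ℕ) i = if i ∈ T then g i else 0 := by
  simp [Finsupp.finsetSum_apply, Finsupp.single_apply]

theorem monomial_mem_of_card_lt {k : ℕ} {c : Fin n →₀ ℕ} {A : Finset (Fin n)}
    (hA : ∀ i ∉ A, (A.filter (i < ·)).card < c i) (hk : A.card < k) :
    monomial c 1 ∈ leadingMonomialIdeal (lexOrder n) (idealJ n k) := by
  obtain ⟨f, hf, h0, hdeg⟩ := exists_degree_eq_skip (Finset.subset_univ Aᶜ) (idealJ n k)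
    fun d hd => esymmOn_univ_mem_idealJ (by
      rw [Finset.card_compl, Fintype.card_fin] at hd
      omega)
  refine monomial_mem_leadingMonomialIdeal_iff.2 ⟨f, hf, h0, fun i => ?_⟩
  rw [hdeg, sum_single_apply]
  split_ifs with hi
  · simpa using hA i (Finset.mem_compl.1 hi)
  · exact Nat.zero_le _

theorem monomial_mem_of_card_lt_apply (k : ℕ) {c : Fin n →₀ ℕ} {A : Finset (Fin n)}
    (hA : ∀ i ∉ A, (A.filter (i < ·)).card < c i) {i : Fin n} (hi : i ∉ A) (hc : A.card < c i) :
    monomial c 1 ∈ leadingMonomialIdeal (lexOrder n) (idealJ n k) := by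
  set x : MvPolynomial (Fin n) ℚ := X i ^ c i with hx
  obtain ⟨f, hf, h0, hdeg⟩ := exists_degree_eq_skip
    (Finset.erase_subset_erase i (Finset.subset_univ Aᶜ))
    -- This is the colon ideal `(J : x_i ^ c_i)`. It contains `e_e^{(i)}` for `e ≥ n - c_i`, and the
    -- set used has `n - #A - 1 ≥ n - c_i` elements.
    (Submodule.comap (LinearMap.mulLeft _ x) (idealJ n k)) fun d hd =>
      X_pow_mul_esymmOn_mem_idealJ k i (by
        rw [Finset.card_erase_of_mem (Finset.mem_compl.2 hi), Finset.card_compl,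
          Fintype.card_fin] at hd
        omega)
  have hxne : x ≠ 0 := pow_ne_zero _ (X_ne_zero i)
  refine monomial_mem_leadingMonomialIdeal_iff.2 ⟨x * f, hf, mul_ne_zero hxne h0, fun j => ?_⟩
  have hsd : Finset.univ.erase i \ Aᶜ.erase i = A := by
    ext j
    by_cases hj : j = i
    · subst hj; simp [hi]
    · simp [hj]
  rw [MonomialOrder.degree_mul hxne h0, MonomialOrder.degree_pow, MonomialOrder.degree_X, hdeg,
    hsd, Finsupp.add_apply, sum_single_apply]
  by_cases hj : j = i
  · subst hj
    simp
  · split_ifs with h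
    · simpa [Finsupp.single_eq_of_ne hj] using hA j (Finset.mem_compl.1 (Finset.mem_of_mem_erase h))
    · simp [Finsupp.single_eq_of_ne hj]

/-! ### Constructing an ordered set partition from its code -/

/-- The set of block minima, read off greedily from a code. -/
theorem exists_greedy_minima (c : Fin n → ℕ) :
    ∃ A : Finset (Fin n), ∀ i, i ∈ A ↔ c i ≤ (A.filter (i < ·)).card := by
  -- Membership of `i` depends only on larger indices, so the top `m` indices are settled by
  -- induction on `m`.
  have h : ∀ m, ∃ A : Finset (Fin n), (∀ i ∈ A, n ≤ i + m) ∧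
      ∀ i : Fin n, n ≤ i + m → (i ∈ A ↔ c i ≤ (A.filter (i < ·)).card) := by
    intro m
    induction m with
    | zero => exact ⟨∅, by simp, fun i hi => absurd i.2 (by omega)⟩
    | succ m ih =>
      obtain ⟨A, hA, hA'⟩ := ih
      by_cases hm : m < n
      · set a : Fin n := ⟨n - m - 1, by omega⟩ with ha
        have haA : a ∉ A := fun h => by
          have := hA a h
          simp only [ha] at this
          omega
        have hle : ∀ i : Fin n, n ≤ i + (m + 1) → i = a ∨ n ≤ i + m := fun i hi => by
          rw [Fin.ext_iff]
          simp only [ha]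
          omega
        have hfa : A.filter (a < ·) = A := Finset.filter_true_of_mem fun i hi => by
          have := hA i hi
          rw [Fin.lt_def]
          simp only [ha]
          omega
        by_cases hc : c a ≤ A.card
        · have hf : ∀ i : Fin n, n ≤ i + (m + 1) →
              (insert a A).filter (i < ·) = A.filter (i < ·) := fun i hi => by
            rw [Finset.filter_insert, if_neg]
            rw [Fin.lt_def]
            simp only [ha]
            omega
          refine ⟨insert a A, fun i hi => ?_, fun i hi => ?_⟩
          · rcases Finset.mem_insert.1 hi with rfl | hi
            · simp only [ha]; omega
            · have := hA i hi; omega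
          · rw [hf i hi]
            rcases hle i hi with rfl | h
            · simp [hfa, hc]
            · rw [← hA' i h, Finset.mem_insert, or_iff_right]
              rintro rfl
              simp only [ha] at h
              omega
        · refine ⟨A, fun i hi => (hA i hi).trans (by omega), fun i hi => ?_⟩
          rcases hle i hi with rfl | h
          · simp [haA, hfa, hc]
          · exact hA' i h
      · exact ⟨A, fun i hi => (hA i hi).trans (by omega), fun i hi => hA' i (by omega)⟩
  obtain ⟨A, -, hA⟩ := h n
  exact ⟨A, fun i => hA i (by omega)⟩

/-- Insert the elements in decreasing order. The new minimum `a` is counted by no other entry, and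
its own count is the number of entries to its right, so position `#s - c a` is forced. -/
theorem exists_enumeration_of_inversions (c : Fin n → ℕ) (A : Finset (Fin n)) :
    (∀ i ∈ A, c i ≤ (A.filter (i < ·)).card) → ∀ ℓ, A.card = ℓ →
    ∃ μ : Fin ℓ → Fin n, Function.Injective μ ∧ Set.range μ = A ∧
      ∀ j, (Finset.univ.filter fun l => j < l ∧ μ j < μ l).card = c (μ j) := by
  induction A using Finset.induction_on_min with
  | empty =>
    rintro - ℓ rfl
    exact ⟨Fin.elim0, fun j => j.elim0, by simp, fun j => j.elim0⟩
  | insert a s has ih =>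
    rintro hc ℓ rfl
    have ha : a ∉ s := fun h => lt_irrefl _ (has a h)
    rw [Finset.card_insert_of_notMem ha]
    obtain ⟨μ, hinj, hrange, hμ⟩ := ih (fun i hi => by
      have := hc i (Finset.mem_insert_of_mem hi)
      rwa [Finset.filter_insert, if_neg (has i hi).not_gt] at this) _ rfl
    have hca : c a ≤ s.card := by
      have := hc a (Finset.mem_insert_self _ _)
      rw [Finset.filter_insert, if_neg (lt_irrefl a)] at this
      exact this.trans (Finset.card_filter_le _ _)
    have hμs : ∀ l, μ l ∈ s := fun l => by
      rw [← Finset.mem_coe, ← hrange]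
      exact ⟨l, rfl⟩
    have haμ : ∀ l, a < μ l := fun l => has _ (hμs l)
    set p : Fin (s.card + 1) := ⟨s.card - c a, by omega⟩ with hp
    refine ⟨p.insertNth a μ, ?_, ?_, ?_⟩
    · intro x y hxy
      rcases Fin.eq_self_or_eq_succAbove p x with rfl | ⟨x, rfl⟩ <;>
        rcases Fin.eq_self_or_eq_succAbove p y with rfl | ⟨y, rfl⟩
      · rfl
      · simp only [Fin.insertNth_apply_same, Fin.insertNth_apply_succAbove] at hxy
        exact absurd hxy (haμ y).ne
      · simp only [Fin.insertNth_apply_same, Fin.insertNth_apply_succAbove] at hxy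
        exact absurd hxy (haμ x).ne'
      · simp only [Fin.insertNth_apply_succAbove] at hxy
        rw [hinj hxy]
    · rw [Fin.range_insertNth, hrange, Finset.coe_insert]
      rfl
    · intro j
      rw [Finset.card_filter, Fin.sum_univ_succAbove _ p]
      rcases Fin.eq_self_or_eq_succAbove p j with h | ⟨j, rfl⟩
      · rw [h]
        simp only [Fin.insertNth_apply_same, Fin.insertNth_apply_succAbove, haμ, lt_self_iff_false,
          and_true, and_self, if_false, zero_add, Fin.lt_succAbove_iff_le_castSucc]
        rw [← Finset.card_filter]
        have h1 := Finset.card_filter_add_card_filter_not (s := (Finset.univ : Finset (Fin s.card)))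
          (fun l => p ≤ l.castSucc)
        have h2 : (Finset.univ.filter fun l : Fin s.card => ¬ p ≤ l.castSucc).card =
            s.card - c a := by
          have h3 : (Finset.univ.filter fun l : Fin s.card => ¬ p ≤ l.castSucc) =
              Finset.univ.filter fun l : Fin s.card => (l : ℕ) < s.card - c a := by
            ext l
            simp [hp, Fin.lt_def]
          rw [h3, Fin.card_filter_val_lt]
          omega
        rw [Finset.card_univ, Fintype.card_fin] at h1
        omega
      · simp only [Fin.insertNth_apply_same, Fin.insertNth_apply_succAbove, (haμ j).not_gt,
          and_false, if_false, zero_add, Fin.succAbove_lt_succAbove_iff]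
        rw [← Finset.card_filter]
        exact hμ j

/-- The required sum equals `#{l : μ l > i} + #{l ≤ j : μ l < i}`. As `j` grows, the second term
rises by one exactly when `μ j < i`, so it reaches `u - s` at such a `j`. -/
theorem exists_block_of_code {ℓ : ℕ} {μ : Fin ℓ → Fin n} {i : Fin n} (hi : ∀ l, μ l ≠ i) {u : ℕ}
    (hu : (Finset.univ.filter fun l => i < μ l).card < u) (hu' : u ≤ ℓ) :
    ∃ j, μ j < i ∧ (Finset.univ.filter fun l => j < l ∧ i < μ l).card + (j + 1) = u := by
  set s := (Finset.univ.filter fun l => i < μ l).card with hs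
  set G : ℕ → ℕ := fun x => (Finset.univ.filter fun l : Fin ℓ => (l : ℕ) < x ∧ μ l < i).card with hG
  have hGℓ : u - s ≤ G ℓ := by
    have h1 : G ℓ = (Finset.univ.filter fun l => ¬ i < μ l).card := by
      simp only [hG]
      congr 1
      ext l
      simp only [Finset.mem_filter, Finset.mem_univ, true_and]
      exact ⟨fun h => h.2.not_gt, fun h => ⟨l.2, (hi l).lt_of_le (not_lt.1 h)⟩⟩
    have h2 := Finset.card_filter_add_card_filter_not (s := (Finset.univ : Finset (Fin ℓ)))
      (fun l => i < μ l)
    rw [Finset.card_univ, Fintype.card_fin] at h2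
    omega
  classical
  -- The shortest prefix containing `u - s` minima below `i` ends at the wanted `j`; `s < u` makes
  -- it nonempty.
  have hex : ∃ x, u - s ≤ G x := ⟨ℓ, hGℓ⟩
  have hfind := Nat.find_spec hex
  have hfl : Nat.find hex ≤ ℓ := Nat.find_min' hex hGℓ
  obtain ⟨y, hy⟩ : ∃ y, Nat.find hex = y + 1 := Nat.exists_eq_succ_of_ne_zero fun h => by
    rw [h] at hfind
    simp [hG] at hfind
    omega
  have hlt : G y < u - s := not_le.1 (Nat.find_min hex (by omega))
  rw [hy] at hfind hfl
  set j : Fin ℓ := ⟨y, by omega⟩ with hj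
  have hstep : (Finset.univ.filter fun l : Fin ℓ => (l : ℕ) < y + 1 ∧ μ l < i) ⊆
      if μ j < i then insert j (Finset.univ.filter fun l : Fin ℓ => (l : ℕ) < y ∧ μ l < i)
      else (Finset.univ.filter fun l : Fin ℓ => (l : ℕ) < y ∧ μ l < i) := by
    intro l hl
    obtain ⟨h1, h2⟩ := (Finset.mem_filter.1 hl).2
    rcases Nat.lt_succ_iff_lt_or_eq.1 h1 with h | h
    · split_ifs <;> simp [h, h2]
    · obtain rfl : l = j := Fin.ext h
      simp [h2]
  have hcard := Finset.card_le_card hstep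
  have hji : μ j < i := by
    by_contra h
    rw [if_neg h] at hcard
    simp only [hG] at hfind hlt
    omega
  refine ⟨j, hji, ?_⟩
  rw [if_pos hji] at hcard
  have hcard2 := hcard.trans (Finset.card_insert_le _ _)
  have e1 : (Finset.univ.filter fun l => j < l ∧ i < μ l).card +
      (Finset.univ.filter fun l : Fin ℓ => (l : ℕ) < y + 1 ∧ i < μ l).card = s := by
    rw [hs, ← Finset.card_filter_add_card_filter_not (s := Finset.univ.filter fun l => i < μ l)
      (fun l => j < l), Finset.filter_filter, Finset.filter_filter]
    congr 2 <;> ext l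
    · simp [and_comm]
    · simp only [Finset.mem_filter, Finset.mem_univ, true_and, not_lt, and_comm (b := i < μ l),
        Nat.lt_succ_iff, Fin.le_def, hj]
  have e2 : (Finset.univ.filter fun l : Fin ℓ => (l : ℕ) < y + 1 ∧ μ l < i).card +
      (Finset.univ.filter fun l : Fin ℓ => (l : ℕ) < y + 1 ∧ i < μ l).card = y + 1 := by
    have h1 : (Finset.univ.filter fun l : Fin ℓ => (l : ℕ) < y + 1).card = y + 1 := by
      rw [Fin.card_filter_val_lt]
      omega
    have h2 := Finset.card_filter_add_card_filter_not
      (s := Finset.univ.filter fun l : Fin ℓ => (l : ℕ) < y + 1) (fun l => μ l < i)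
    rw [Finset.filter_filter, Finset.filter_filter, h1] at h2
    refine Eq.trans ?_ h2
    congr 2
    ext l
    simp only [Finset.mem_filter, Finset.mem_univ, true_and, not_lt]
    exact and_congr_right fun _ => ⟨le_of_lt, (hi l).symm.lt_of_le⟩
  simp only [hG] at hfind hlt
  have : (j : ℕ) = y := rfl
  omega

/-- The ordered set partition with a given block index function. -/
def OrderedSetPartition.ofIndex {ℓ : ℕ} (blk : Fin n → Fin ℓ) (h : Function.Surjective blk) :
    OrderedSetPartition n ℓ where
  block j := Finset.univ.filter fun i => blk i = j
  block_nonempty j := (h j).imp fun i hi => by simpa using hi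
  existsUnique_mem i := ⟨blk i, by simp, fun j hj => by simpa [eq_comm] using hj⟩

theorem exists_boostedCode_eq {c : Fin n → ℕ} {A : Finset (Fin n)}
    (hA : ∀ i, i ∈ A ↔ c i ≤ (A.filter (i < ·)).card) (hc : ∀ i, c i ≤ A.card) :
    ∃ σ : OrderedSetPartition n A.card, σ.boostedCode = c := by
  obtain ⟨μ, hinj, hrange, hμ⟩ :=
    exists_enumeration_of_inversions c A (fun i hi => (hA i).1 hi) _ rfl
  have hmem : ∀ i, i ∈ A ↔ ∃ l, μ l = i := fun i => by
    rw [← Finset.mem_coe, ← hrange]; rfl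
  have hcount : ∀ i, (Finset.univ.filter fun l => i < μ l).card = (A.filter (i < ·)).card :=
    fun i => by
      rw [← Finset.card_image_of_injective _ hinj]
      congr 1
      ext x
      simp only [Finset.mem_image, Finset.mem_filter, Finset.mem_univ, true_and, hmem]
      constructor
      · rintro ⟨l, h, rfl⟩; exact ⟨⟨l, rfl⟩, h⟩
      · rintro ⟨⟨l, rfl⟩, h⟩; exact ⟨l, h, rfl⟩
  -- Requiring `μ j < i` for a non-minimum ensures that adding `i` to block `j` does not change its
  -- minimum.
  have hblk : ∀ i, ∃ j, μ j = i ∨ ((∀ l, μ l ≠ i) ∧ μ j < i ∧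
      (Finset.univ.filter fun l => j < l ∧ i < μ l).card + (j + 1) = c i) := fun i => by
    by_cases hi : i ∈ A
    · obtain ⟨j, hj⟩ := (hmem i).1 hi
      exact ⟨j, Or.inl hj⟩
    · have hne : ∀ l, μ l ≠ i := fun l h => hi ((hmem i).2 ⟨l, h⟩)
      obtain ⟨j, hj⟩ := exists_block_of_code hne (u := c i)
        (by rw [hcount]; exact not_le.1 fun h => hi ((hA i).2 h)) (hc i)
      exact ⟨j, Or.inr ⟨hne, hj⟩⟩
  choose blk hblk using hblk
  have hblkμ : ∀ j, blk (μ j) = j := fun j => (hblk (μ j)).elim (fun h => hinj h)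
    fun h => absurd rfl (h.1 j)
  set σ := OrderedSetPartition.ofIndex blk fun j => ⟨μ j, hblkμ j⟩ with hσ
  have hidx : ∀ i, σ.blockIndex i = blk i := fun i =>
    σ.blockIndex_eq (by simp [hσ, OrderedSetPartition.ofIndex])
  have hmin : ∀ j, σ.blockMin j = μ j := fun j => by
    refine le_antisymm (Finset.min'_le _ _ (by simp [hσ, OrderedSetPartition.ofIndex, hblkμ]))
      (Finset.le_min' _ _ _ fun i hi => ?_)
    obtain rfl : blk i = j := by simpa [hσ, OrderedSetPartition.ofIndex] using hi
    exact (hblk i).elim le_of_eq fun h => h.2.1.le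
  refine ⟨σ, funext fun i => ?_⟩
  rw [OrderedSetPartition.boostedCode, hidx]
  simp only [hmin]
  rcases hblk i with h | ⟨h1, -, h2⟩
  · rw [if_pos h.symm, add_zero]
    conv_rhs => rw [← h, ← hμ, h]
  · rw [if_neg (h1 _).symm, h2]

theorem standardMonomials_subset (n k : ℕ) :
    standardMonomials (lexOrder n) (idealJ n k) ⊆ codeMonomials n k := by
  rintro _ ⟨⟨c, rfl⟩, hc⟩
  obtain ⟨A, hA⟩ := exists_greedy_minima c
  have hA' : ∀ i ∉ A, (A.filter (i < ·)).card < c i := fun i hi =>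
    not_le.1 fun h => hi ((hA i).2 h)
  have hk : k ≤ A.card := not_lt.1 fun h => hc (monomial_mem_of_card_lt hA' h)
  have hle : ∀ i, c i ≤ A.card := fun i => not_lt.1 fun h => by
    by_cases hi : i ∈ A
    · exact absurd (((hA i).1 hi).trans (Finset.card_filter_le _ _)) (not_le.2 h)
    · exact hc (monomial_mem_of_card_lt_apply k hA' hi h)
  obtain ⟨σ, hσ⟩ := exists_boostedCode_eq hA hle
  refine ⟨_, σ, hk, ?_⟩
  rw [hσ, monomial_eq, Finsupp.prod_fintype _ _ (by simp)]
  simp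

end StdMonomials

theorem mainTheorem5 (n k : ℕ) (hk : 1 ≤ k) (hkn : k ≤ n) :
    StdMonomials.standardMonomials (StdMonomials.lexOrder n) (StdMonomials.idealJ n k) =
        StdMonomials.codeMonomials n k ∧
      ∃ b : Module.Basis (StdMonomials.codeMonomials n k) ℚ (StdMonomials.QuotientS n k),
        ∀ p : StdMonomials.codeMonomials n k,
          b p = Ideal.Quotient.mk (StdMonomials.idealJ n k) (p : MvPolynomial (Fin n) ℚ) := by
  have h := StdMonomials.standardMonomials_eq_of_subset _
    (StdMonomials.standardMonomials_subset n k)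
  refine ⟨h, ?_⟩
  rw [← h]
  exact StdMonomials.exists_basis_standardMonomials _ _
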